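/- Let $n\in\{1,2,\dots\}$ or $n=\infty$, let $\mathbb F_n^+$ be the unital free semigroup on generators $g_i$ ($1\le i\le n$, or $i\in\mathbb N$ if $n=\infty$) with neutral element $g_0$ and length function $|\cdot|$, and for a tuple $X=(X_i)$ of bounded operators on a complex Hilbert space put $X_\alpha:=X_{i_1}\cdots X_{i_k}$ if $\alpha=g_{i_1}\cdots g_{i_k}$ and $X_{g_0}:=I$. Let $f=\sum_{\alpha\in\mathbb F_n^+}a_\alpha X_\alpha$ be a positive regular free holomorphic function: $a_\alpha\ge 0$, $a_{g_0}=0$, $a_{g_i}>0$ for every $i$, and $\limsup_{k\to\infty}\big(\sum_{|\alpha|=k}|a_\alpha|^2\big)^{1/2k}<\infty$. Let $m\ge1$ be an integer and let $\mathcal P$ be a set of noncommutative polynomials in the given indeterminates. For a complex Hilbert space $\mathcal H$ and $X=(X_i)$ with $X_i\in B(\mathcal H)$, put $\Phi_{f,X}(Y):=\sum_{|\alpha|\ge1}a_\alpha X_\alpha YX_\alpha^*$ for $Y\in B(\mathcal H)$, where the convergence is in the weak operator topology. Let $\mathcal V^m_{f,\mathcal P}(\mathcal H)$ be the set of all $X$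 such that this series converges for every $Y$, $(id-\Phi_{f,X})^s(I)\ge0$ for $s=1,\dots,m$, and $p(X)=0$ for all $p\in\mathcal P$. The tuple $X$ is called pure if $\Phi_{f,X}^k(I)\to0$ strongly as $k\to\infty$. Let $F^2(H_n)$ be the full Fock space on $n$ generators with orthonormal basis $\{e_\alpha\}_{\alpha\in\mathbb F_n^+}$, let $$b_{g_0}:=1,\qquad b_\alpha:=\sum_{j=1}^{|\alpha|}\ \sum_{\substack{\gamma_1\cdots\gamma_j=\alpha\\ |\gamma_1|,\dots,|\gamma_j|\ge1}}a_{\gamma_1}\cdots a_{\gamma_j}\binom{j+m-1}{m-1}\quad(|\alpha|\ge1),$$ and let $W_i\in B(F^2(H_n))$ be the weighted left creation operators $W_ie_\alpha=\sqrt{b_\alpha/b_{g_i\alpha}}\;e_{g_i\alpha}$. Put $$\mathcal M_{\mathcal P}:=\overline{\operatorname{span}}\{W_\alpha\,p(W)\,W_\beta e_{g_0}:p\in\mathcal P,\ \alpha,\beta\in\mathbb F_n^+\},\qquad \mathcal N_{\mathcal P}:=F^2(H_n)\ominus\mathcal M_{\mathcal P},\qquad B_i:=P_{\mathcal N_{\mathcal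 P}}W_i|_{\mathcal N_{\mathcal P}}.$$ **Theorem.** Let $\mathcal H$ be a complex Hilbert space and let $T=(T_i)$ be a tuple of operators in $B(\mathcal H)$. Then $T\in\mathcal V^m_{f,\mathcal P}(\mathcal H)$ and $T$ is pure if and only if there exist a closed subspace $\mathcal G\subseteq\mathcal N_{\mathcal P}\otimes\mathcal D$ (Hilbert space tensor product), invariant under every $B_i^*\otimes I_{\mathcal D}$, and a unitary operator $U:\mathcal H\to\mathcal G$ such that $$T_i^*=U^*\big[(B_i^*\otimes I_{\mathcal D})|_{\mathcal G}\big]U\qquad\text{for every } i,$$ where $\mathcal D:=\overline{\big[(id-\Phi_{f,T})^m(I)\big]^{1/2}(\mathcal H)}$. (In the "if" direction no condition on $\mathcal D$ is presupposed: where the formula for $\mathcal D$ is not meaningful, because a series defining $\Phi_{f,T}$ diverges or $(id-\Phi_{f,T})^m(I)$ is not positive, a divergent series is read as $0$ and the square root of a non-positive operator as $0$.) -/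

import Mathlib

open Filter Topology TensorProduct UniformSpace
open scoped ENNReal

noncomputable section

namespace NCVariety

/-- A positive regular free holomorphic function `f = ∑ a_α X_α` in the variables `X_i`, `i : ι`,
given by its coefficients `a_α`, where `α` runs over the free monoid (words) on `ι`. -/
structure PosRegFreeHol (ι : Type*) where
  coeff : FreeMonoid ι → ℝ
  limsup_lt_top : limsup (fun k : ℕ =>
    (∑' α : {α : FreeMonoid ι // α.length = k}, ENNReal.ofReal (|coeff α| ^ 2)) ^
      (1 / (2 * (k : ℝ)))) atTop < ⊤
  coeff_nonneg : ∀ α, 0 ≤ coeff α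
  coeff_one : coeff 1 = 0
  coeff_of_pos : ∀ i, 0 < coeff (FreeMonoid.of i)

section Tensor

variable (E D : Type*) [NormedAddCommGroup E] [InnerProductSpace ℂ E]
  [NormedAddCommGroup D] [InnerProductSpace ℂ D]

/-- The Hilbert space tensor product `E ⊗ D`: the completion of the algebraic tensor product with
the inner product `⟪x ⊗ y, x' ⊗ y'⟫ = ⟪x, x'⟫ ⟪y, y'⟫`. -/
abbrev HilbertTensor : Type _ := Completion (E ⊗[ℂ] D)

variable {E}

/-- The operator `A ⊗ I_D` on the Hilbert space tensor product `E ⊗ D`. -/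
def tensorId (A : E →L[ℂ] E) : HilbertTensor E D →L[ℂ] HilbertTensor E D :=
  (A.rTensor D).completion

end Tensor

section Domain

variable {ι : Type*} {H : Type*} [NormedAddCommGroup H] [InnerProductSpace ℂ H] [CompleteSpace H]

/-- The monomial `X_α = X_{i₁} ⋯ X_{i_k}` for `α = g_{i₁} ⋯ g_{i_k}`, and `X_1 = I`. -/
def monomial (X : ι → H →L[ℂ] H) (α : FreeMonoid ι) : H →L[ℂ] H :=
  FreeMonoid.lift X α

/-- The term `a_α X_α Y X_α^*` of the series for `Φ_{f,X}(Y)`, regarded in the weak operator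
topology. -/
def phiTerm (f : PosRegFreeHol ι) (X : ι → H →L[ℂ] H) (Y : H →L[ℂ] H) (α : FreeMonoid ι) :
    H →WOT[ℂ] H :=
  ContinuousLinearMapWOT.ofCLM
    ((f.coeff α : ℂ) • (monomial X α * Y * ContinuousLinearMap.adjoint (monomial X α)))

/-- The series for `Φ_{f,X}(Y)` converges in the weak operator topology, for every `Y`. -/
def PhiConverges (f : PosRegFreeHol ι) (X : ι → H →L[ℂ] H) : Prop :=
  ∀ Y : H →L[ℂ] H, Summable (phiTerm f X Y)

/-- The map `Φ_{f,X}(Y) = ∑ a_α X_α Y X_α^*`, a sum in the weak operator topology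
(the empty word contributes nothing, as its coefficient vanishes). -/
def phi (f : PosRegFreeHol ι) (X : ι → H →L[ℂ] H) (Y : H →L[ℂ] H) : H →L[ℂ] H :=
  (∑' α, phiTerm f X Y α).toCLM

/-- The operator `(id - Φ_{f,X})^s (I)`. -/
def defect (f : PosRegFreeHol ι) (X : ι → H →L[ℂ] H) (s : ℕ) : H →L[ℂ] H :=
  (fun Y => Y - phi f X Y)^[s] 1

/-- The noncommutative domain `D_f^m(H)`. -/
def domain (f : PosRegFreeHol ι) (m : ℕ) (H : Type*) [NormedAddCommGroup H]
    [InnerProductSpace ℂ H] [CompleteSpace H] : Set (ι → H →L[ℂ] H) :=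
  {X | PhiConverges f X ∧ ∀ s, 1 ≤ s → s ≤ m → (defect f X s).IsPositive}

/-- The noncommutative variety `V_{f,P}^m(H)`, for a set `P` of noncommutative polynomials. -/
def variety (f : PosRegFreeHol ι) (m : ℕ) (P : Set (FreeAlgebra ℂ ι)) (H : Type*)
    [NormedAddCommGroup H] [InnerProductSpace ℂ H] [CompleteSpace H] : Set (ι → H →L[ℂ] H) :=
  {X | X ∈ domain f m H ∧ ∀ p ∈ P, FreeAlgebra.lift ℂ X p = 0}

/-- `X` is pure: `Φ_{f,X}^k(I) → 0` in the strong operator topology. -/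
def IsPure (f : PosRegFreeHol ι) (X : ι → H →L[ℂ] H) : Prop :=
  ∀ h : H, Tendsto (fun k : ℕ => ((phi f X)^[k] 1) h) atTop (𝓝 0)

/-- The space `𝒟`, the closure of the range of `[(id - Φ_{f,X})^m (I)]^{1/2}`. -/
def defectSpace (f : PosRegFreeHol ι) (m : ℕ) (X : ι → H →L[ℂ] H) : Submodule ℂ H :=
  (LinearMap.range (CFC.sqrt (defect f X m)).toLinearMap).topologicalClosure

instance (f : PosRegFreeHol ι) (m : ℕ) (X : ι → H →L[ℂ] H) :
    CompleteSpace (defectSpace f m X) :=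
  (Submodule.isClosed_topologicalClosure _).completeSpace_coe

end Domain

section Fock

variable {ι : Type*}

/-- The coefficients `b_α^{(m)} = ∑_j ∑_{γ₁⋯γ_j = α, |γ_i| ≥ 1} a_{γ₁} ⋯ a_{γ_j} C(j+m-1, m-1)`;
the factorizations of `α` into `j` nonempty words correspond to the compositions of the number
`|α|` with `j` blocks. The empty word has only the empty factorization, so `b_1 = 1`. -/
def bCoeff (f : PosRegFreeHol ι) (m : ℕ) (α : FreeMonoid ι) : ℝ :=
  ∑ c : Composition α.toList.length,
    ((α.toList.splitWrtComposition c).map fun γ => f.coeff (FreeMonoid.ofList γ)).prod *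
      ((c.length + m - 1).choose (m - 1) : ℝ)

lemma bCoeff_one (f : PosRegFreeHol ι) (m : ℕ) : bCoeff f m 1 = 1 := by
  have key : ∀ c : Composition 0,
      ((([] : List ι).splitWrtComposition c).map fun γ => f.coeff (FreeMonoid.ofList γ)).prod *
        ((c.length + m - 1).choose (m - 1) : ℝ) = 1 := by
    intro c
    have hb : c.blocks = [] := c.blocks_eq_nil.2 rfl
    have hl : c.length = 0 := c.length_eq_zero.2 rfl
    simp [List.splitWrtComposition, hb, hl, List.splitWrtCompositionAux]
  calc bCoeff f m 1 = ∑ _c : Composition 0, (1 : ℝ) :=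
        Finset.sum_congr rfl fun c _ => key c
    _ = 1 := by simp [composition_card]

lemma coeff_mul_bCoeff_le (f : PosRegFreeHol ι) (m : ℕ) (i : ι) (α : FreeMonoid ι) :
    f.coeff (FreeMonoid.of i) * bCoeff f m α ≤ bCoeff f m (FreeMonoid.of i * α) := by
  let t : ∀ l : List ι, Composition l.length → ℝ := fun l c =>
    ((l.splitWrtComposition c).map fun γ => f.coeff (FreeMonoid.ofList γ)).prod *
      ((c.length + m - 1).choose (m - 1) : ℝ)
  have hprod : ∀ L : List (List ι),
      0 ≤ (L.map fun γ => f.coeff (FreeMonoid.ofList γ)).prod := by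
    intro L
    apply List.prod_nonneg
    intro x hx
    obtain ⟨γ, -, rfl⟩ := List.mem_map.1 hx
    exact f.coeff_nonneg _
  have ht : ∀ l c, 0 ≤ t l c := fun l c => mul_nonneg (hprod _) (Nat.cast_nonneg _)
  let e : Composition α.toList.length → Composition (i :: α.toList).length := fun c =>
    { blocks := 1 :: c.blocks
      blocks_pos := by
        intro j hj
        rcases List.mem_cons.1 hj with rfl | hj
        · exact Nat.one_pos
        · exact c.blocks_pos hj
      blocks_sum := by simp [c.blocks_sum, add_comm] }
  have he : Function.Injective e := by
    intro c d h
    have h' : (1 :: c.blocks) = 1 :: d.blocks := congrArg Composition.blocks h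
    exact Composition.ext (List.cons_injective h')
  have hstep : ∀ c, f.coeff (FreeMonoid.of i) * t α.toList c ≤ t (i :: α.toList) (e c) := by
    intro c
    have hs : (i :: α.toList).splitWrtComposition (e c) =
        [i] :: α.toList.splitWrtComposition c := by
      simp [List.splitWrtComposition, e, List.splitWrtCompositionAux]
    have hlen : (e c).length = c.length + 1 := by simp [Composition.length, e]
    simp only [t]
    rw [hs, hlen, List.map_cons, List.prod_cons, mul_assoc]
    refine mul_le_mul_of_nonneg_left ?_ (f.coeff_nonneg _)
    refine mul_le_mul_of_nonneg_left ?_ (hprod _)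
    exact_mod_cast Nat.choose_le_choose _ (by omega)
  change f.coeff (FreeMonoid.of i) * ∑ c, t α.toList c ≤ ∑ c, t (i :: α.toList) c
  rw [Finset.mul_sum]
  calc ∑ c, f.coeff (FreeMonoid.of i) * t α.toList c
      ≤ ∑ c, t (i :: α.toList) (e c) := Finset.sum_le_sum fun c _ => hstep c
    _ = ∑ c ∈ Finset.univ.map ⟨e, he⟩, t (i :: α.toList) c := by rw [Finset.sum_map]; rfl
    _ ≤ ∑ c, t (i :: α.toList) c :=
        Finset.sum_le_sum_of_subset_of_nonneg (Finset.subset_univ _) fun c _ _ => ht _ c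

lemma bCoeff_pos (f : PosRegFreeHol ι) (m : ℕ) (α : FreeMonoid ι) : 0 < bCoeff f m α := by
  induction α using FreeMonoid.inductionOn' with
  | one => rw [bCoeff_one]; exact one_pos
  | of_mul i α ih =>
    exact (mul_pos (f.coeff_of_pos i) ih).trans_le (coeff_mul_bCoeff_le f m i α)

/-- The full Fock space `F²(H_n)`, where `n` is the cardinality of `ι`, realized as `ℓ²` of the
free monoid through its orthonormal basis `e_α = e_{i₁} ⊗ ⋯ ⊗ e_{i_k}`. -/
abbrev Fock (ι : Type*) : Type _ := lp (fun _ : FreeMonoid ι => ℂ) 2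

open Classical in
/-- The basis vector `e_α`. -/
def fockBasis (α : FreeMonoid ι) : Fock ι := lp.single 2 α (1 : ℂ)

lemma orthonormal_fockBasis : Orthonormal ℂ (fockBasis (ι := ι)) := by
  classical
  rw [orthonormal_iff_ite]
  intro α β
  simp only [fockBasis]
  rw [lp.inner_single_left, lp.single_apply]
  by_cases h : α = β
  · subst h; simp
  · simp [h]

lemma orthonormal_of_mul (i : ι) :
    Orthonormal ℂ fun α : FreeMonoid ι => fockBasis (FreeMonoid.of i * α) :=
  orthonormal_fockBasis.comp _ fun _ _ h => mul_left_cancel h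

/-- The left creation operator `S_i`, the isometry with `S_i e_α = e_{g_i α}`. -/
def leftCreation (i : ι) : Fock ι →ₗᵢ[ℂ] Fock ι :=
  (orthonormal_of_mul i).orthogonalFamily.linearIsometry

lemma norm_diag_le (f : PosRegFreeHol ι) (m : ℕ) (i : ι) (α : FreeMonoid ι) :
    ‖((√(bCoeff f m α / bCoeff f m (FreeMonoid.of i * α)) : ℝ) : ℂ) •
      ContinuousLinearMap.id ℂ ℂ‖ ≤ √(1 / f.coeff (FreeMonoid.of i)) := by
  have h1 : bCoeff f m α / bCoeff f m (FreeMonoid.of i * α) ≤ 1 / f.coeff (FreeMonoid.of i) := by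
    rw [div_le_div_iff₀ (bCoeff_pos _ _ _) (f.coeff_of_pos i), one_mul, mul_comm]
    exact coeff_mul_bCoeff_le f m i α
  rw [norm_smul, ContinuousLinearMap.norm_id, mul_one, Complex.norm_real, Real.norm_eq_abs,
    abs_of_nonneg (Real.sqrt_nonneg _)]
  exact Real.sqrt_le_sqrt h1

/-- The diagonal operator `D_i e_α = √(b_α / b_{g_i α}) e_α`. -/
def diag (f : PosRegFreeHol ι) (m : ℕ) (i : ι) : Fock ι →L[ℂ] Fock ι :=
  lp.mapCLM 2 (fun α => ((√(bCoeff f m α / bCoeff f m (FreeMonoid.of i * α)) : ℝ) : ℂ) •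
      ContinuousLinearMap.id ℂ ℂ)
    (Real.sqrt_nonneg (1 / f.coeff (FreeMonoid.of i))) (norm_diag_le f m i)

/-- The weighted left creation operator `W_i = S_i D_i`. -/
def W (f : PosRegFreeHol ι) (m : ℕ) (i : ι) : Fock ι →L[ℂ] Fock ι :=
  (leftCreation i).toContinuousLinearMap ∘L diag f m i

/-- The subspace `M_P`, the closed span of the vectors `W_α p(W) W_β (1)` with `p ∈ P`. -/
def M (f : PosRegFreeHol ι) (m : ℕ) (P : Set (FreeAlgebra ℂ ι)) : Submodule ℂ (Fock ι) :=
  (Submodule.span ℂ {x | ∃ p ∈ P, ∃ α β : FreeMonoid ι,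
    x = monomial (W f m) α (FreeAlgebra.lift ℂ (W f m) p
      (monomial (W f m) β (fockBasis 1)))}).topologicalClosure

/-- The subspace `N_P`, the orthogonal complement of `M_P` in the Fock space. -/
def N (f : PosRegFreeHol ι) (m : ℕ) (P : Set (FreeAlgebra ℂ ι)) : Submodule ℂ (Fock ι) :=
  (M f m P)ᗮ

instance (f : PosRegFreeHol ι) (m : ℕ) (P : Set (FreeAlgebra ℂ ι)) :
    CompleteSpace (N f m P) :=
  (Submodule.isClosed_orthogonal _).completeSpace_coe

/-- The universal model `B_i = P_{N_P} W_i |_{N_P}` of the variety `V_{f,P}^m`. -/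
def B (f : PosRegFreeHol ι) (m : ℕ) (P : Set (FreeAlgebra ℂ ι)) (i : ι) :
    N f m P →L[ℂ] N f m P :=
  (N f m P).orthogonalProjectionOnto ∘L W f m i ∘L (N f m P).subtypeL

/-- The operator `B_i^* ⊗ I_D` on the Hilbert space tensor product `N_P ⊗ D`. -/
def adjointBTensor (f : PosRegFreeHol ι) (m : ℕ) (P : Set (FreeAlgebra ℂ ι)) (D : Type*)
    [NormedAddCommGroup D] [InnerProductSpace ℂ D] (i : ι) :
    HilbertTensor (N f m P) D →L[ℂ] HilbertTensor (N f m P) D :=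
  tensorId D (ContinuousLinearMap.adjoint (B f m P i))

end Fock

end NCVariety

end

/-! Operators are traded for their quadratic forms. On functions `q : H → [0,∞]` the map `Φ` acts by
`q ↦ ∑ a_α q(T_α^* ·)`, and `(id - Φ)^{-s}` becomes the series `resolventForm f T s q = ∑_j C(j+s-1,
j) Φ^j q`, which always makes sense in `[0,∞]`. Grouping lists of words by their concatenation shows
that the `b_α` are the coefficients of the m-th inverse power: `∑ b_α q(T_α^* h) = resolventForm f T
m q h` (`tsum_bCoeff_eq_resolventForm`).

Both directions pass through the single identity `resolventForm f T m q h = ‖h‖²` for all `h`. If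
`T` is pure and lies in the domain, the identity holds with `q` the form of the m-th defect
operator, by telescoping (`resolventForm_opForm_defect`). It says that the Poisson kernel `h ↦ (√b_α
Δ^{1/2} T_α^* h)_α` is an isometry into `ℓ²` of the free monoid, where `Δ` is the m-th defect; this
isometry intertwines `T_i^*` with backward weighted shifts (`exists_isometry_of_resolventForm_eq`).

Conversely, the shift relation forces every intertwining isometry to have the form `h ↦ (√b_α C
T_α^* h)_α`, with `C` its coordinate at the empty word. Its norm identity is the same identity with
`q = ‖C ·‖²`, and membership in the domain and purity are read off from it
(`mem_variety_of_isometry`).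

The polynomials enter through `inner_generator_eq`: pairing a slice of the kernel with a generator
of `M_P` gives a coordinate of the kernel at `T_β^* p(T)^* T_α^* h`. Hence `p(T) = 0` puts the
slices in `N_P`, and slices in `N_P` force `p(T) = 0`. -/

noncomputable section

namespace NCVariety

/-! ### The calculus of `Φ` and its inverse powers on `[0,∞]`-valued functions. -/

section Forms

variable {ι : Type*} {H : Type*} [NormedAddCommGroup H] [InnerProductSpace ℂ H] [CompleteSpace H]

lemma adjoint_monomial_one (T : ι → H →L[ℂ] H) (h : H) :
    ContinuousLinearMap.adjoint (monomial T 1) h = h := by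
  have : monomial T 1 = ContinuousLinearMap.id ℂ H := map_one (FreeMonoid.lift T)
  rw [this, ContinuousLinearMap.adjoint_id]; rfl

lemma adjoint_monomial_mul (T : ι → H →L[ℂ] H) (α β : FreeMonoid ι) (h : H) :
    ContinuousLinearMap.adjoint (monomial T (α * β)) h =
      ContinuousLinearMap.adjoint (monomial T β) (ContinuousLinearMap.adjoint (monomial T α) h) := by
  have : monomial T (α * β) = monomial T α ∘L monomial T β := map_mul (FreeMonoid.lift T) α β
  rw [this, ContinuousLinearMap.adjoint_comp]; rfl

/-- The action `q ↦ ∑ a_α q(T_α^* ·)` of `Φ_{f,T}` on nonnegative functions. -/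
def phiForm (f : PosRegFreeHol ι) (T : ι → H →L[ℂ] H) (q : H → ℝ≥0∞) (h : H) : ℝ≥0∞ :=
  ∑' α, ENNReal.ofReal (f.coeff α) * q (ContinuousLinearMap.adjoint (monomial T α) h)

variable (f : PosRegFreeHol ι) (T : ι → H →L[ℂ] H)

lemma phiForm_mono : Monotone (phiForm f T) := fun _ _ hq _ =>
  ENNReal.tsum_le_tsum fun _ => mul_le_mul_right (hq _) _

lemma phiForm_add (q r : H → ℝ≥0∞) : phiForm f T (q + r) = phiForm f T q + phiForm f T r := by
  ext h; simp [phiForm, mul_add, ENNReal.tsum_add]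

lemma phiForm_tsum (w : ℕ → ℝ≥0∞) (q : ℕ → H → ℝ≥0∞) :
    phiForm f T (fun h => ∑' j, w j * q j h) = fun h => ∑' j, w j * phiForm f T (q j) h := by
  ext h
  simp only [phiForm, ← ENNReal.tsum_mul_left]
  rw [ENNReal.tsum_comm]
  simp only [mul_left_comm]

lemma iterate_phiForm_tsum (k : ℕ) (w : ℕ → ℝ≥0∞) (q : ℕ → H → ℝ≥0∞) :
    (phiForm f T)^[k] (fun h => ∑' j, w j * q j h) =
      fun h => ∑' j, w j * (phiForm f T)^[k] (q j) h := by
  induction k with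
  | zero => rfl
  | succ k ih => simp only [Function.iterate_succ_apply', ih, phiForm_tsum]

/-- The action of `(id - Φ_{f,T})^{-s} = ∑_j C(j+s-1, j) Φ_{f,T}^j` on nonnegative functions. -/
def resolventForm (s : ℕ) (q : H → ℝ≥0∞) (h : H) : ℝ≥0∞ :=
  ∑' j : ℕ, (s.multichoose j : ℝ≥0∞) * (phiForm f T)^[j] q h

lemma resolventForm_zero (q : H → ℝ≥0∞) : resolventForm f T 0 q = q := by
  ext h
  rw [resolventForm, tsum_eq_single 0]
  · simp
  · intro j hj
    obtain ⟨k, rfl⟩ := Nat.exists_eq_succ_of_ne_zero hj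
    simp

lemma iterate_phiForm_resolventForm (k s : ℕ) (q : H → ℝ≥0∞) (h : H) :
    (phiForm f T)^[k] (resolventForm f T s q) h =
      ∑' j : ℕ, (s.multichoose j : ℝ≥0∞) * (phiForm f T)^[j + k] q h := by
  have := iterate_phiForm_tsum f T k (fun j => (s.multichoose j : ℝ≥0∞))
    (fun j => (phiForm f T)^[j] q)
  simp only [← Function.iterate_add_apply] at this
  change (phiForm f T)^[k] (fun h => ∑' j : ℕ, _) h = _
  rw [this]
  simp only [add_comm]

/-- Pascal's rule for `multichoose`, applied termwise. This is `(id - Φ)(id - Φ)^{-(s+1)} = (id -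
Φ)^{-s}`, written additively because subtraction in `[0,∞]` is truncated. -/
lemma resolventForm_succ (s : ℕ) (q : H → ℝ≥0∞) :
    resolventForm f T (s + 1) q =
      resolventForm f T s q + phiForm f T (resolventForm f T (s + 1) q) := by
  ext h
  have := iterate_phiForm_resolventForm f T 1 (s + 1) q h
  rw [Function.iterate_one] at this
  rw [Pi.add_apply, this, resolventForm, resolventForm, tsum_eq_zero_add' ENNReal.summable,
    tsum_eq_zero_add' (f := fun j : ℕ => (s.multichoose j : ℝ≥0∞) * (phiForm f T)^[j] q h)
      ENNReal.summable, add_assoc, ← ENNReal.tsum_add]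
  simp [Nat.multichoose_succ_succ, add_mul]

lemma sum_multichoose (s N : ℕ) :
    ∑ p ∈ Finset.HasAntidiagonal.antidiagonal N, s.multichoose p.1 = (s + 1).multichoose N := by
  rw [Finset.Nat.sum_antidiagonal_eq_sum_range_succ (fun i _ => s.multichoose i)]
  induction N with
  | zero => simp
  | succ N ih => rw [Finset.sum_range_succ, ih, Nat.multichoose_succ_succ, add_comm]

/-- The Cauchy product of the two power series in `Φ`; summing over antidiagonals reduces it to
`sum_multichoose`. -/
lemma resolventForm_resolventForm_one (s : ℕ) (q : H → ℝ≥0∞) :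
    resolventForm f T s (resolventForm f T 1 q) = resolventForm f T (s + 1) q := by
  ext h
  have h1 : ∀ j : ℕ, (s.multichoose j : ℝ≥0∞) *
      (phiForm f T)^[j] (resolventForm f T 1 q) h =
      ∑' k : ℕ, (s.multichoose j : ℝ≥0∞) * (phiForm f T)^[k + j] q h := by
    intro j
    rw [iterate_phiForm_resolventForm, ← ENNReal.tsum_mul_left]
    simp [Nat.multichoose_one]
  rw [resolventForm, tsum_congr h1, ← ENNReal.tsum_prod,
    ← Finset.HasAntidiagonal.sigmaAntidiagonalEquivProd.tsum_eq, ENNReal.tsum_sigma']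
  refine tsum_congr fun N => ?_
  rw [tsum_fintype, ← sum_multichoose, Nat.cast_sum, Finset.sum_mul]
  rw [← Finset.sum_coe_sort (Finset.HasAntidiagonal.antidiagonal N)]
  refine Finset.sum_congr rfl fun p _ => ?_
  have := Finset.HasAntidiagonal.mem_antidiagonal.1 p.2
  simp [← this, add_comm]

/-- Expanding `Φ^j` gives one term for each list of `j` words, with the concatenated word acting.
Empty words are still allowed in the lists; they have coefficient zero and are discarded later. -/
lemma tsum_list_eq_iterate_phiForm (q : H → ℝ≥0∞) (j : ℕ) (h : H) :
    ∑' L : List (List ι), (if L.length = j then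
      (L.map fun γ => ENNReal.ofReal (f.coeff (FreeMonoid.ofList γ))).prod *
        q (ContinuousLinearMap.adjoint (monomial T (FreeMonoid.ofList L.flatten)) h) else 0) =
      (phiForm f T)^[j] q h := by
  induction j generalizing h with
  | zero =>
    rw [tsum_eq_single []]
    · simp only [List.length_nil, if_true, List.map_nil, List.prod_nil, List.flatten_nil, one_mul,
        Function.iterate_zero, id]
      rw [FreeMonoid.ofList_nil, adjoint_monomial_one]
    · intro L hL
      rw [if_neg (by simpa using hL)]
  | succ j ih =>
    have hinj : Function.Injective fun p : List ι × List (List ι) => p.1 :: p.2 := by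
      rintro ⟨a, b⟩ ⟨c, d⟩ h
      simpa using h
    rw [← hinj.tsum_eq, ENNReal.tsum_prod', Function.iterate_succ_apply', phiForm,
      ← FreeMonoid.ofList.tsum_eq]
    · refine tsum_congr fun γ => ?_
      rw [← ih, ← ENNReal.tsum_mul_left]
      refine tsum_congr fun L => ?_
      simp only [List.length_cons, add_left_inj, List.map_cons, List.prod_cons, List.flatten_cons]
      split_ifs
      · rw [FreeMonoid.ofList_append, adjoint_monomial_mul, mul_assoc]
      · simp
    · intro L hL
      cases L with
      | nil => simp at hL
      | cons γ L => exact ⟨(γ, L), rfl⟩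

lemma ofReal_bCoeff (m : ℕ) (hm : 1 ≤ m) (α : FreeMonoid ι) :
    ENNReal.ofReal (bCoeff f m α) = ∑' c : Composition α.toList.length,
      ((α.toList.splitWrtComposition c).map
        fun γ => ENNReal.ofReal (f.coeff (FreeMonoid.ofList γ))).prod *
        (m.multichoose (α.toList.splitWrtComposition c).length : ℝ≥0∞) := by
  have hprod : ∀ L : List (List ι), 0 ≤ (L.map fun γ => f.coeff (FreeMonoid.ofList γ)).prod ∧
      ENNReal.ofReal (L.map fun γ => f.coeff (FreeMonoid.ofList γ)).prod =
      (L.map fun γ => ENNReal.ofReal (f.coeff (FreeMonoid.ofList γ))).prod := by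
    intro L
    induction L with
    | nil => simp
    | cons γ L ih =>
      simp only [List.map_cons, List.prod_cons]
      exact ⟨mul_nonneg (f.coeff_nonneg _) ih.1,
        by rw [ENNReal.ofReal_mul (f.coeff_nonneg _), ih.2]⟩
  rw [bCoeff, ENNReal.ofReal_sum_of_nonneg, tsum_fintype]
  · refine Finset.sum_congr rfl fun c _ => ?_
    rw [ENNReal.ofReal_mul (hprod _).1, (hprod _).2, ENNReal.ofReal_natCast,
      List.length_splitWrtComposition, Nat.multichoose_eq]
    congr 2
    -- Here `1 ≤ m` keeps the truncated subtraction `m - 1` honest.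
    rw [← Nat.choose_symm_of_eq_add (by omega : c.length + m - 1 = c.length + (m - 1)),
      add_comm m]
  · exact fun c _ => mul_nonneg (hprod _).1 (Nat.cast_nonneg _)

/-- A word together with a composition of its length is the same as a list of nonempty words. Lists
containing an empty word contribute zero since `f.coeff 1 = 0`, so the sum runs over all lists and
can be regrouped by list length. -/
lemma tsum_bCoeff_eq_resolventForm (m : ℕ) (hm : 1 ≤ m) (q : H → ℝ≥0∞) (h : H) :
    ∑' α, ENNReal.ofReal (bCoeff f m α) *
      q (ContinuousLinearMap.adjoint (monomial T α) h) = resolventForm f T m q h := by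
  let F : List (List ι) → ℝ≥0∞ := fun L =>
    (L.map fun γ => ENNReal.ofReal (f.coeff (FreeMonoid.ofList γ))).prod *
      (m.multichoose L.length : ℝ≥0∞) *
        q (ContinuousLinearMap.adjoint (monomial T (FreeMonoid.ofList L.flatten)) h)
  let e : (Σ α : FreeMonoid ι, Composition α.toList.length) → List (List ι) :=
    fun p => p.1.toList.splitWrtComposition p.2
  -- Concatenating the blocks recovers the word, and the block lengths recover the composition.
  have he : Function.Injective e := by
    rintro ⟨l, c⟩ ⟨l', c'⟩ hp
    have h1 : l = l' := by
      have := congrArg List.flatten hp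
      exact FreeMonoid.toList.injective
        (by simpa only [e, List.flatten_splitWrtComposition] using this)
    subst h1
    have h2 : c.blocks = c'.blocks := by
      have := congrArg (List.map List.length) hp
      simpa only [e, List.map_length_splitWrtComposition] using this
    rw [Composition.ext h2]
  have hF : Function.support F ⊆ Set.range e := by
    intro L hL
    have h0 : ∀ γ ∈ L, γ ≠ [] := by
      rintro γ hγ rfl
      refine hL ?_
      have : (L.map fun γ => ENNReal.ofReal (f.coeff (FreeMonoid.ofList γ))).prod = 0 :=
        List.prod_eq_zero (List.mem_map.2 ⟨[], hγ, by
          rw [FreeMonoid.ofList_nil, f.coeff_one, ENNReal.ofReal_zero]⟩)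
      simp [F, this]
    refine ⟨⟨FreeMonoid.ofList L.flatten, ⟨L.map List.length, ?_, ?_⟩⟩, ?_⟩
    · intro j hj
      obtain ⟨γ, hγ, rfl⟩ := List.mem_map.1 hj
      exact List.length_pos_iff.2 (h0 γ hγ)
    · simp [List.length_flatten]
    · exact List.splitWrtComposition_flatten L _ rfl
  calc ∑' α, ENNReal.ofReal (bCoeff f m α) * q (ContinuousLinearMap.adjoint (monomial T α) h)
      = ∑' (α : FreeMonoid ι) (c : Composition α.toList.length), F (e ⟨α, c⟩) := by
        refine tsum_congr fun α => ?_
        rw [ofReal_bCoeff f m hm, ← ENNReal.tsum_mul_right]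
        refine tsum_congr fun c => ?_
        simp only [F, e, List.flatten_splitWrtComposition, FreeMonoid.ofList_toList]
    _ = ∑' L, F L := by rw [← ENNReal.tsum_sigma (fun α c => F (e ⟨α, c⟩)), ← he.tsum_eq hF]
    _ = ∑' (L : List (List ι)) (j : ℕ), (if L.length = j then F L else 0) :=
        tsum_congr fun L => by simp
    _ = resolventForm f T m q h := by
        rw [ENNReal.tsum_comm, resolventForm]
        refine tsum_congr fun j => ?_
        rw [← tsum_list_eq_iterate_phiForm, ← ENNReal.tsum_mul_left]
        refine tsum_congr fun L => ?_
        split_ifs with hj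
        · subst hj; simp only [F]; ring
        · simp

end Forms

/-! ### Columns of operators into `ℓ²`. -/

section SquareSummable

variable {κ E H : Type*} [NormedAddCommGroup E] [NormedAddCommGroup H]

lemma enorm_sq_eq_ofReal (x : E) : ‖x‖ₑ ^ 2 = ENNReal.ofReal (‖x‖ ^ 2) := by
  rw [← ofReal_norm, ENNReal.ofReal_pow (norm_nonneg x)]

lemma memℓp_two_of_tsum_enorm_ne_top {x : κ → E} (hx : ∑' k, ‖x k‖ₑ ^ 2 ≠ ⊤) : Memℓp x 2 := by
  refine memℓp_gen ?_
  have := ENNReal.summable_toReal hx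
  simpa using this

lemma lp_enorm_sq (x : lp (fun _ : κ => E) 2) : ‖x‖ₑ ^ 2 = ∑' k, ‖x k‖ₑ ^ 2 := by
  have h := lp.hasSum_norm (p := 2) (by simp) x
  simp only [ENNReal.toReal_ofNat, Real.rpow_two] at h
  simp only [enorm_sq_eq_ofReal]
  rw [← h.tsum_eq, ENNReal.ofReal_tsum_of_nonneg (fun _ => sq_nonneg _) h.summable]

lemma norm_le_of_enorm_sq_le {x : E} {y : H}
    (h : ‖x‖ₑ ^ 2 ≤ ‖y‖ₑ ^ 2) : ‖x‖ ≤ ‖y‖ := by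
  have h' : ‖x‖ₑ ≤ ‖y‖ₑ := (ENNReal.pow_le_pow_left_iff two_ne_zero).1 h
  rwa [← ofReal_norm, ← ofReal_norm, ENNReal.ofReal_le_ofReal_iff (norm_nonneg _)] at h'

variable [InnerProductSpace ℂ E] [InnerProductSpace ℂ H]

/-- The operator `h ↦ (A_k h)_k` into `ℓ²(κ; E)` of a family with `∑ ‖A_k h‖² ≤ ‖h‖²`. -/
def ofSquareSummable (A : κ → H →L[ℂ] E) (hA : ∀ h, ∑' k, ‖A k h‖ₑ ^ 2 ≤ ‖h‖ₑ ^ 2) :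
    H →L[ℂ] lp (fun _ : κ => E) 2 :=
  LinearMap.mkContinuous
    { toFun := fun h => ⟨fun k => A k h, memℓp_two_of_tsum_enorm_ne_top
        ((hA h).trans_lt (ENNReal.pow_lt_top enorm_lt_top)).ne⟩
      map_add' := fun x y => by ext k; exact map_add (A k) x y
      map_smul' := fun c x => by ext k; exact map_smul (A k) c x }
    1 fun h => by
      rw [one_mul]
      refine norm_le_of_enorm_sq_le ?_
      rw [lp_enorm_sq]
      exact hA h

end SquareSummable

/-! ### Positive operators and their quadratic forms. -/

section Positive

variable {H : Type*} [NormedAddCommGroup H] [InnerProductSpace ℂ H]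

lemma isPositive_of_inner_nonneg (A : H →L[ℂ] H)
    (hA : ∀ h, 0 ≤ (inner ℂ h (A h)).re ∧ (inner ℂ h (A h)).im = 0) : A.IsPositive := by
  rw [ContinuousLinearMap.isPositive_iff_complex]
  intro x
  have h1 : inner ℂ (A x) x = starRingEnd ℂ (inner ℂ x (A x)) := (inner_conj_symm _ _).symm
  rw [h1]
  rw [Complex.conj_eq_iff_im.2 (hA x).2]
  exact ⟨Complex.ext rfl (hA x).2.symm, (hA x).1⟩

lemma inner_re_nonneg_of_isPositive {A : H →L[ℂ] H} (hA : A.IsPositive) (h : H) :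
    0 ≤ (inner ℂ h (A h)).re := hA.re_inner_nonneg_right h

lemma inner_im_eq_zero_of_isPositive {A : H →L[ℂ] H} (hA : A.IsPositive) (h : H) :
    (inner ℂ h (A h)).im = 0 := by
  have := hA.inner_nonneg_right h
  exact ((Complex.le_def.1 this).2).symm

/-- The quadratic form `h ↦ ⟪h, Y h⟫` of a positive operator. -/
def opForm (Y : H →L[ℂ] H) (h : H) : ℝ≥0∞ := ENNReal.ofReal (inner ℂ h (Y h)).re

lemma opForm_one : opForm (1 : H →L[ℂ] H) = fun h => ‖h‖ₑ ^ 2 := by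
  ext h
  rw [enorm_sq_eq_ofReal, opForm]
  congr 1
  exact inner_self_eq_norm_sq (𝕜 := ℂ) h

lemma opForm_ne_top (Y : H →L[ℂ] H) (h : H) : opForm Y h ≠ ⊤ := ENNReal.ofReal_ne_top

/-- The bridge from additive identities in `[0,∞]` back to operator inequalities; cancelling is
legitimate because `opForm Z` is finite. -/
lemma isPositive_sub_of_opForm_eq_add {Y Z : H →L[ℂ] H} (hY : Y.IsPositive) (hZ : Z.IsPositive)
    {r : H → ℝ≥0∞} (hr : opForm Y = r + opForm Z) : (Y - Z).IsPositive ∧ opForm (Y - Z) = r := by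
  have hsub : ∀ h, inner ℂ h ((Y - Z) h) = inner ℂ h (Y h) - inner ℂ h (Z h) := fun h => by
    rw [sub_apply, inner_sub_right]
  constructor
  · refine isPositive_of_inner_nonneg _ fun h => ?_
    rw [hsub, Complex.sub_re, Complex.sub_im, inner_im_eq_zero_of_isPositive hY,
      inner_im_eq_zero_of_isPositive hZ, sub_zero, sub_nonneg]
    refine ⟨(ENNReal.ofReal_le_ofReal_iff (inner_re_nonneg_of_isPositive hY h)).1 ?_, rfl⟩
    have := congrFun hr h
    simp only [opForm, Pi.add_apply] at this
    rw [this]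
    exact le_add_self
  · ext h
    rw [opForm, hsub, Complex.sub_re, ENNReal.ofReal_sub _ (inner_re_nonneg_of_isPositive hZ h)]
    change opForm Y h - opForm Z h = r h
    rw [hr, Pi.add_apply, ENNReal.add_sub_cancel_right (opForm_ne_top _ _)]

lemma opForm_eq_add_of_isPositive_sub {Y Z : H →L[ℂ] H} (hZ : Z.IsPositive)
    (hYZ : (Y - Z).IsPositive) : opForm Y = opForm (Y - Z) + opForm Z := by
  ext h
  rw [Pi.add_apply, opForm, opForm, opForm, ← ENNReal.ofReal_add (inner_re_nonneg_of_isPositive hYZ h)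
    (inner_re_nonneg_of_isPositive hZ h)]
  congr 1
  rw [← Complex.add_re, ← inner_add_right, sub_apply, sub_add_cancel]

variable [CompleteSpace H]

lemma opForm_eq_enorm_sqrt {A : H →L[ℂ] H} (hA : A.IsPositive) (h : H) :
    opForm A h = ‖CFC.sqrt A h‖ₑ ^ 2 := by
  have hA' : 0 ≤ A := A.nonneg_iff_isPositive.2 hA
  have hs : (CFC.sqrt A).IsPositive :=
    (ContinuousLinearMap.nonneg_iff_isPositive _).1 (CFC.sqrt_nonneg A)
  rw [enorm_sq_eq_ofReal, opForm]
  congr 1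
  rw [← inner_self_eq_norm_sq (𝕜 := ℂ), hs.inner_left_eq_inner_right,
    ← mul_apply_eq_comp, CFC.sqrt_mul_sqrt_self A hA']
  rfl

/-- For `0 ≤ A ≤ I`, writing `A = √A √A` gives `A² ≤ A`. This upgrades convergence of the forms to
strong convergence in the proof of purity. -/
lemma enorm_apply_sq_le_opForm {A : H →L[ℂ] H} (hA : A.IsPositive)
    (hle : ∀ h, opForm A h ≤ ‖h‖ₑ ^ 2) (h : H) : ‖A h‖ₑ ^ 2 ≤ opForm A h := by
  have hA' : 0 ≤ A := A.nonneg_iff_isPositive.2 hA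
  have h1 : A h = CFC.sqrt A (CFC.sqrt A h) := by
    rw [← mul_apply_eq_comp, CFC.sqrt_mul_sqrt_self A hA']
  rw [h1, ← opForm_eq_enorm_sqrt hA, opForm_eq_enorm_sqrt hA h]
  exact hle _

end Positive

/-! ### The domain and purity expressed through quadratic forms. -/

section Domain

variable {ι : Type*} {H : Type*} [NormedAddCommGroup H] [InnerProductSpace ℂ H] [CompleteSpace H]
  {f : PosRegFreeHol ι} {T : ι → H →L[ℂ] H}

lemma inner_phiTerm (Y : H →L[ℂ] H) (α : FreeMonoid ι) (x y : H) :
    inner ℂ x (phiTerm f T Y α y) =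
      f.coeff α * inner ℂ (ContinuousLinearMap.adjoint (monomial T α) x)
        (Y (ContinuousLinearMap.adjoint (monomial T α) y)) := by
  rw [ContinuousLinearMap.adjoint_inner_left]
  simp [phiTerm]

lemma sum_phiTerm_apply (Y : H →L[ℂ] H) (s : Finset (FreeMonoid ι)) (y : H) :
    (∑ α ∈ s, phiTerm f T Y α) y = ∑ α ∈ s, phiTerm f T Y α y := by
  induction s using Finset.cons_induction with
  | empty => simp
  | cons a s ha ih => simp [Finset.sum_cons, ih]

/-- With `R` the contractive column `(√a_α T_α^*)_α`, the sum is `R^* (⊕ Y) R`. Weak convergence of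
the series is then summability of the `ℓ²` inner product `⟪R x, (⊕ Y) R y⟫`. -/
lemma phiConverges_of_phiForm_le
    (hT : ∀ h, phiForm f T (fun h => ‖h‖ₑ ^ 2) h ≤ ‖h‖ₑ ^ 2) : PhiConverges f T := by
  intro Y
  let A : FreeMonoid ι → H →L[ℂ] H := fun α =>
    ((√(f.coeff α) : ℝ) : ℂ) • ContinuousLinearMap.adjoint (monomial T α)
  have hA : ∀ h, ∑' α, ‖A α h‖ₑ ^ 2 ≤ ‖h‖ₑ ^ 2 := by
    intro h
    refine le_of_eq_of_le (tsum_congr fun α => ?_) (hT h)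
    beta_reduce
    rw [enorm_sq_eq_ofReal, enorm_sq_eq_ofReal, ← ENNReal.ofReal_mul (f.coeff_nonneg α)]
    congr 1
    simp only [A, smul_apply]
    rw [norm_smul, mul_pow, Complex.norm_real, Real.norm_eq_abs, sq_abs,
      Real.sq_sqrt (f.coeff_nonneg α)]
  let R := ofSquareSummable A hA
  let D : lp (fun _ : FreeMonoid ι => H) 2 →L[ℂ] lp (fun _ : FreeMonoid ι => H) 2 :=
    lp.mapCLM 2 (fun _ => Y) (norm_nonneg Y) (fun _ => le_rfl)
  refine ⟨ContinuousLinearMapWOT.ofCLM (ContinuousLinearMap.adjoint R ∘L D ∘L R), ?_⟩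
  rw [HasSum, ContinuousLinearMapWOT.tendsto_iff_forall_inner_apply_tendsto]
  intro y x
  have h1 : inner ℂ x (ContinuousLinearMapWOT.ofCLM (ContinuousLinearMap.adjoint R ∘L D ∘L R) y) =
      inner ℂ (R x) (D (R y)) := by
    simp [ContinuousLinearMap.adjoint_inner_right]
  rw [h1]
  refine (lp.hasSum_inner (R x) (D (R y))).congr fun s => ?_
  rw [sum_phiTerm_apply, inner_sum]
  refine Finset.sum_congr rfl fun α _ => ?_
  rw [inner_phiTerm]
  have h3 : ((√(f.coeff α) : ℝ) : ℂ) * ((√(f.coeff α) : ℝ) : ℂ) = f.coeff α := by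
    rw [← Complex.ofReal_mul, Real.mul_self_sqrt (f.coeff_nonneg α)]
  have h4 : (D (R y)) α = Y (A α y) := rfl
  have h5 : (R x) α = A α x := rfl
  refine (congrArg₂ (inner ℂ) h5 h4).trans ?_
  simp only [A, smul_apply, map_smul, inner_smul_left, inner_smul_right,
    Complex.conj_ofReal, ← mul_assoc, h3]

lemma hasSum_inner_phi (hT : PhiConverges f T) (Y : H →L[ℂ] H) (x y : H) :
    HasSum (fun α => (f.coeff α : ℂ) * inner ℂ (ContinuousLinearMap.adjoint (monomial T α) x)
        (Y (ContinuousLinearMap.adjoint (monomial T α) y))) (inner ℂ x (phi f T Y y)) := by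
  have h := ContinuousLinearMapWOT.tendsto_iff_forall_inner_apply_tendsto.1 (hT Y).hasSum y x
  simp only [sum_phiTerm_apply, inner_sum, inner_phiTerm] at h
  exact h

lemma isPositive_phi (hT : PhiConverges f T) {Y : H →L[ℂ] H} (hY : Y.IsPositive) :
    (phi f T Y).IsPositive := by
  refine isPositive_of_inner_nonneg _ fun h => ?_
  have hs := hasSum_inner_phi hT Y h h
  constructor
  · refine (Complex.hasSum_re hs).nonneg fun α => ?_
    rw [Complex.re_ofReal_mul]
    exact mul_nonneg (f.coeff_nonneg α) (inner_re_nonneg_of_isPositive hY _)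
  · refine (Complex.hasSum_im hs).unique ?_
    simp [inner_im_eq_zero_of_isPositive hY, hasSum_zero]

lemma opForm_phi (hT : PhiConverges f T) {Y : H →L[ℂ] H} (hY : Y.IsPositive) :
    opForm (phi f T Y) = phiForm f T (opForm Y) := by
  ext h
  have hs := Complex.hasSum_re (hasSum_inner_phi hT Y h h)
  simp only [Complex.re_ofReal_mul] at hs
  rw [opForm, ← hs.tsum_eq, ENNReal.ofReal_tsum_of_nonneg _ hs.summable]
  · exact tsum_congr fun α => ENNReal.ofReal_mul (f.coeff_nonneg α)
  · exact fun α => mul_nonneg (f.coeff_nonneg α) (inner_re_nonneg_of_isPositive hY _)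

lemma iterate_phi_one (hT : PhiConverges f T) (k : ℕ) :
    ((phi f T)^[k] 1).IsPositive ∧
      opForm ((phi f T)^[k] 1) = (phiForm f T)^[k] (fun h => ‖h‖ₑ ^ 2) := by
  induction k with
  | zero => exact ⟨ContinuousLinearMap.isPositive_one, opForm_one⟩
  | succ k ih =>
    rw [Function.iterate_succ_apply', Function.iterate_succ_apply', ← ih.2]
    exact ⟨isPositive_phi hT ih.1, opForm_phi hT ih.1⟩

lemma defect_succ (s : ℕ) : defect f T (s + 1) = defect f T s - phi f T (defect f T s) :=
  Function.iterate_succ_apply' _ _ _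

lemma multichoose_mono {m : ℕ} (hm : 1 ≤ m) : Monotone m.multichoose := by
  obtain ⟨s, rfl⟩ := Nat.exists_eq_add_of_le' hm
  refine monotone_nat_of_le_succ fun k => ?_
  rw [Nat.multichoose_succ_succ]
  exact Nat.le_add_left _ _

/-! ### From the resolvent identity to the domain and purity. -/

section Sufficiency

variable {m : ℕ} {q : H → ℝ≥0∞}

lemma phiForm_enorm_sq_le (hm : 1 ≤ m)
    (hq : ∀ h, resolventForm f T m q h = ‖h‖ₑ ^ 2) (h : H) :
    phiForm f T (fun h => ‖h‖ₑ ^ 2) h ≤ ‖h‖ₑ ^ 2 := by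
  have hq' : resolventForm f T m q = fun h => ‖h‖ₑ ^ 2 := funext hq
  obtain ⟨s, rfl⟩ := Nat.exists_eq_add_of_le' hm
  have := congrFun (resolventForm_succ f T s q) h
  rw [hq', Pi.add_apply] at this
  exact le_of_le_of_eq le_add_self this.symm

/-- Each application of `id - Φ` lowers the exponent of the resolvent by one, by
`resolventForm_succ`; the remaining form is nonnegative, so the defect stays positive. -/
lemma defect_isPositive_of_resolventForm_eq (hm : 1 ≤ m)
    (hq : ∀ h, resolventForm f T m q h = ‖h‖ₑ ^ 2) (s : ℕ) (hs : s ≤ m) :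
    (defect f T s).IsPositive ∧ opForm (defect f T s) = resolventForm f T (m - s) q := by
  have hT := phiConverges_of_phiForm_le (phiForm_enorm_sq_le hm hq)
  induction s with
  | zero =>
    exact ⟨ContinuousLinearMap.isPositive_one, opForm_one.trans (funext fun h => (hq h).symm)⟩
  | succ s ih =>
    obtain ⟨hp, he⟩ := ih (by omega)
    rw [defect_succ]
    refine isPositive_sub_of_opForm_eq_add hp (isPositive_phi hT hp) ?_
    rw [opForm_phi hT hp, he, show m - s = (m - (s + 1)) + 1 by omega]
    exact resolventForm_succ f T _ q

lemma tendsto_iterate_phiForm (hm : 1 ≤ m)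
    (hq : ∀ h, resolventForm f T m q h = ‖h‖ₑ ^ 2) (h : H) :
    Tendsto (fun k => (phiForm f T)^[k] (fun h => ‖h‖ₑ ^ 2) h) atTop (𝓝 0) := by
  have hq' : resolventForm f T m q = fun h => ‖h‖ₑ ^ 2 := funext hq
  have hfin : ∑' j : ℕ, (m.multichoose j : ℝ≥0∞) * (phiForm f T)^[j] q h ≠ ⊤ := by
    change resolventForm f T m q h ≠ ⊤
    rw [hq]
    exact (ENNReal.pow_lt_top enorm_lt_top).ne
  refine tendsto_of_tendsto_of_tendsto_of_le_of_le tendsto_const_nhds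
    (ENNReal.tendsto_sum_nat_add _ hfin) (fun _ => zero_le) fun k => ?_
  -- Since `m.multichoose` is monotone, replacing its argument `j` by `j + k` bounds `Φ^k(‖·‖²)` by
  -- the k-th tail of the convergent series for `‖h‖²`.
  simp only [← hq', iterate_phiForm_resolventForm]
  refine ENNReal.tsum_le_tsum fun j => mul_le_mul_left ?_ _
  exact_mod_cast multichoose_mono hm (Nat.le_add_right j k)

lemma mem_domain_of_resolventForm_eq (hm : 1 ≤ m)
    (hq : ∀ h, resolventForm f T m q h = ‖h‖ₑ ^ 2) : T ∈ domain f m H :=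
  ⟨phiConverges_of_phiForm_le (phiForm_enorm_sq_le hm hq), fun s _ hs =>
    (defect_isPositive_of_resolventForm_eq hm hq s hs).1⟩

lemma isPure_of_resolventForm_eq (hm : 1 ≤ m)
    (hq : ∀ h, resolventForm f T m q h = ‖h‖ₑ ^ 2) : IsPure f T := by
  intro h
  have hle := phiForm_enorm_sq_le hm hq
  have hT := phiConverges_of_phiForm_le hle
  have hle' : ∀ k h, (phiForm f T)^[k] (fun h => ‖h‖ₑ ^ 2) h ≤ ‖h‖ₑ ^ 2 := by
    intro k
    induction k with
    | zero => exact fun h => le_rfl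
    | succ k ih =>
      intro h
      rw [Function.iterate_succ_apply']
      exact (phiForm_mono f T ih h).trans (hle h)
  have hbound : ∀ k, ‖((phi f T)^[k] 1) h‖ₑ ^ 2 ≤ (phiForm f T)^[k] (fun h => ‖h‖ₑ ^ 2) h := by
    intro k
    obtain ⟨hp, he⟩ := iterate_phi_one hT k
    rw [← he]
    refine enorm_apply_sq_le_opForm hp (fun h => ?_) h
    rw [he]
    exact hle' k h
  have h0 := tendsto_of_tendsto_of_tendsto_of_le_of_le tendsto_const_nhds
    (tendsto_iterate_phiForm hm hq h) (fun _ => zero_le) hbound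
  rw [tendsto_zero_iff_norm_tendsto_zero]
  have h1 := (ENNReal.tendsto_toReal ENNReal.zero_ne_top).comp h0
  have h2 := (Real.continuous_sqrt.tendsto _).comp h1
  simpa [Function.comp_def] using h2

end Sufficiency

/-- With `Δ_s` the defect of order `s`, iterating `Δ_s = Δ_{s+1} + Φ(Δ_s)` telescopes to `Δ_s =
∑_{k<K} Φ^k(Δ_{s+1}) + Φ^K(Δ_s)`. Positivity of the defects gives `Δ_s ≤ I`, so purity sends the
remainder to zero. -/
lemma opForm_defect_eq_resolventForm_one {m : ℕ} (hT : T ∈ domain f m H) (hp : IsPure f T)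
    {s : ℕ} (hs : s < m) :
    opForm (defect f T s) = resolventForm f T 1 (opForm (defect f T (s + 1))) := by
  have hpos : ∀ s ≤ m, (defect f T s).IsPositive := by
    intro s hs
    rcases Nat.eq_zero_or_pos s with rfl | h0
    · exact ContinuousLinearMap.isPositive_one
    · exact hT.2 s h0 hs
  have hrec : ∀ s < m, opForm (defect f T s) =
      opForm (defect f T (s + 1)) + phiForm f T (opForm (defect f T s)) := by
    intro s hs
    have h1 := hpos (s + 1) hs
    rw [defect_succ] at h1 ⊢
    rw [← opForm_phi hT.1 (hpos s hs.le)]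
    exact opForm_eq_add_of_isPositive_sub (isPositive_phi hT.1 (hpos s hs.le)) h1
  have hle : ∀ s ≤ m, opForm (defect f T s) ≤ fun h => ‖h‖ₑ ^ 2 := by
    intro s
    induction s with
    | zero => exact fun _ => opForm_one.le
    | succ s ih =>
      intro hs h
      refine le_trans ?_ (ih (by omega) h)
      rw [hrec s hs]
      exact le_self_add
  have htel : ∀ K, opForm (defect f T s) =
      (fun h => ∑ k ∈ Finset.range K, (phiForm f T)^[k] (opForm (defect f T (s + 1))) h) +
        (phiForm f T)^[K] (opForm (defect f T s)) := by
    intro K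
    induction K with
    | zero => ext h; simp
    | succ K ih =>
      have hadd : ∀ q r, (phiForm f T)^[K] (q + r) = (phiForm f T)^[K] q + (phiForm f T)^[K] r :=
        fun q r => Function.Semiconj₂.iterate (phiForm_add f T) K q r
      have h2 := congrArg ((phiForm f T)^[K]) (hrec s hs)
      rw [hadd, ← Function.iterate_succ_apply] at h2
      rw [h2] at ih
      refine ih.trans ?_
      ext h
      simp only [Pi.add_apply, Finset.sum_range_succ, add_assoc]
  ext h
  have hlim : Tendsto (fun K => (phiForm f T)^[K] (opForm (defect f T s)) h) atTop (𝓝 0) := by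
    refine tendsto_of_tendsto_of_tendsto_of_le_of_le tendsto_const_nhds
      (h := fun K => (phiForm f T)^[K] (fun h => ‖h‖ₑ ^ 2) h) ?_ (fun _ => zero_le)
      fun K => (phiForm_mono f T).iterate K (hle s hs.le) h
    simp only [← (iterate_phi_one hT.1 _).2, opForm]
    have h1 : Tendsto (fun K => inner ℂ h (((phi f T)^[K] 1) h)) atTop (𝓝 (inner ℂ h 0)) :=
      tendsto_const_nhds.inner (hp h)
    have h2 := (ENNReal.continuous_ofReal.comp Complex.continuous_re).tendsto _ |>.comp h1
    simpa [Function.comp_def] using h2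
  have h3 := (ENNReal.tendsto_nat_tsum
    (fun k => (phiForm f T)^[k] (opForm (defect f T (s + 1))) h)).add hlim
  have h4 : Tendsto (fun _ : ℕ => opForm (defect f T s) h) atTop
      (𝓝 (∑' k, (phiForm f T)^[k] (opForm (defect f T (s + 1))) h + 0)) :=
    h3.congr fun K => (congrFun (htel K) h).symm
  have h5 := tendsto_nhds_unique tendsto_const_nhds h4
  simpa [resolventForm, Nat.multichoose_one] using h5

lemma resolventForm_opForm_defect {m : ℕ} (hT : T ∈ domain f m H) (hp : IsPure f T) :
    resolventForm f T m (opForm (defect f T m)) = fun h => ‖h‖ₑ ^ 2 := by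
  have key : ∀ s ≤ m, resolventForm f T s (opForm (defect f T s)) = fun h => ‖h‖ₑ ^ 2 := by
    intro s
    induction s with
    | zero => exact fun _ => (resolventForm_zero f T _).trans opForm_one
    | succ s ih =>
      intro hs
      rw [← ih (by omega), opForm_defect_eq_resolventForm_one hT hp hs,
        resolventForm_resolventForm_one]
  exact key m le_rfl

end Domain

/-! ### Intertwining relations pass from generators to polynomials and monomials. -/

section Intertwining

variable {ι E F : Type*} [NormedAddCommGroup E] [InnerProductSpace ℂ E] [CompleteSpace E]
  [NormedAddCommGroup F] [InnerProductSpace ℂ F] [CompleteSpace F]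
  {X : ι → E →L[ℂ] E} {Z : ι → F →L[ℂ] F} {K : E →L[ℂ] F}

lemma adjoint_lift_intertwine
    (hK : ∀ i h, K (ContinuousLinearMap.adjoint (X i) h) =
      ContinuousLinearMap.adjoint (Z i) (K h)) (p : FreeAlgebra ℂ ι) :
    ∀ h, K (ContinuousLinearMap.adjoint (FreeAlgebra.lift ℂ X p) h) =
      ContinuousLinearMap.adjoint (FreeAlgebra.lift ℂ Z p) (K h) := by
  induction p using FreeAlgebra.induction with
  | grade0 r =>
    intro h
    rw [AlgHom.commutes, AlgHom.commutes, Algebra.algebraMap_eq_smul_one,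
      Algebra.algebraMap_eq_smul_one, map_smulₛₗ, map_smulₛₗ]
    simp [← ContinuousLinearMap.star_eq_adjoint]
  | grade1 i => simpa using hK i
  | mul a b ha hb =>
    intro h
    simp only [_root_.map_mul (FreeAlgebra.lift ℂ _), ContinuousLinearMap.mul_def,
      ContinuousLinearMap.adjoint_comp, ContinuousLinearMap.comp_apply, ha, hb]
  | add a b ha hb =>
    intro h
    simp [ha, hb]

lemma adjoint_monomial_intertwine
    (hK : ∀ i h, K (ContinuousLinearMap.adjoint (X i) h) =
      ContinuousLinearMap.adjoint (Z i) (K h)) (α : FreeMonoid ι) :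
    ∀ h, K (ContinuousLinearMap.adjoint (monomial X α) h) =
      ContinuousLinearMap.adjoint (monomial Z α) (K h) := by
  induction α using FreeMonoid.inductionOn' with
  | one => simp [adjoint_monomial_one]
  | of_mul i α ih =>
    intro h
    rw [adjoint_monomial_mul, adjoint_monomial_mul, ih]
    congr 1
    simpa [monomial] using hK i h

end Intertwining

/-! ### The Hilbert space tensor product inside `ℓ²(κ; D)`. -/

section Tensor

variable {κ D : Type*} [NormedAddCommGroup D] [InnerProductSpace ℂ D]

/-- The slice `x ↦ (⟪y, x_k⟫)_k` of vectors in `ℓ²(κ; D)`. -/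
def slice (y : D) : lp (fun _ : κ => D) 2 →L[ℂ] lp (fun _ : κ => ℂ) 2 :=
  lp.mapCLM 2 (fun _ => innerSL ℂ y) (norm_nonneg _) (fun _ => le_rfl)

lemma slice_apply (y : D) (x : lp (fun _ : κ => D) 2) (k : κ) :
    slice y x k = inner ℂ y (x k) := rfl

/-- The vector `(n_k d)_k` of `ℓ²(κ; D)`. -/
def l2Smul (n : lp (fun _ : κ => ℂ) 2) (d : D) : lp (fun _ : κ => D) 2 :=
  lp.mapCLM 2 (fun _ => ContinuousLinearMap.toSpanSingleton ℂ d) (norm_nonneg _)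
    (fun _ => le_rfl) n

lemma l2Smul_apply (n : lp (fun _ : κ => ℂ) 2) (d : D) (k : κ) : l2Smul n d k = n k • d := rfl

lemma inner_l2Smul (n : lp (fun _ : κ => ℂ) 2) (d : D) (x : lp (fun _ : κ => D) 2) :
    inner ℂ (l2Smul n d) x = inner ℂ n (slice d x) := by
  rw [lp.inner_eq_tsum, lp.inner_eq_tsum]
  refine tsum_congr fun k => ?_
  rw [l2Smul_apply, slice_apply, inner_smul_left, RCLike.inner_apply, mul_comm]

lemma slice_l2Smul (y : D) (n : lp (fun _ : κ => ℂ) 2) (d : D) :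
    slice y (l2Smul n d) = (inner ℂ y d : ℂ) • n := by
  ext k
  rw [slice_apply, l2Smul_apply, inner_smul_right, lp.coeFn_smul, Pi.smul_apply, smul_eq_mul,
    mul_comm]

variable {E : Type*} [NormedAddCommGroup E] [InnerProductSpace ℂ E]

/-- Two continuous linear maps on `E ⊗ D` agree if they agree on elementary tensors. -/
lemma hilbertTensor_ext {F : Type*} [NormedAddCommGroup F] [NormedSpace ℂ F]
    {A B : HilbertTensor E D →L[ℂ] F}
    (h : ∀ (n : E) (d : D), A ((n ⊗ₜ[ℂ] d : E ⊗[ℂ] D) : HilbertTensor E D) =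
      B ((n ⊗ₜ[ℂ] d : E ⊗[ℂ] D) : HilbertTensor E D)) (x : HilbertTensor E D) : A x = B x := by
  induction x using Completion.induction_on with
  | hp => exact isClosed_eq A.continuous B.continuous
  | ih x =>
    induction x using TensorProduct.induction_on with
    | zero => rw [Completion.coe_zero, map_zero, map_zero]
    | add x y hx hy => rw [Completion.coe_add, map_add, map_add, hx, hy]
    | tmul n d => exact h n d

variable (D) (j : E →ₗᵢ[ℂ] lp (fun _ : κ => ℂ) 2)

/-- The linear map `n ⊗ d ↦ (j(n)_k d)_k` on the algebraic tensor product. -/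
def tensorToL2 : (E ⊗[ℂ] D) →ₗ[ℂ] lp (fun _ : κ => D) 2 :=
  TensorProduct.lift (LinearMap.mk₂ ℂ (fun (n : E) (d : D) => l2Smul (j n) d)
    (fun n n' d => by
      ext k; simp only [map_add, lp.coeFn_add, Pi.add_apply, l2Smul_apply, add_smul])
    (fun c n d => by
      ext k; simp only [map_smul, lp.coeFn_smul, Pi.smul_apply, l2Smul_apply, smul_assoc])
    (fun n d d' => by ext k; exact smul_add (j n k) d d')
    (fun c n d => by ext k; exact smul_comm (j n k) c d))

lemma tensorToL2_tmul (n : E) (d : D) : tensorToL2 D j (n ⊗ₜ d) = l2Smul (j n) d := rfl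

lemma inner_tensorToL2 (x y : E ⊗[ℂ] D) :
    inner ℂ (tensorToL2 D j x) (tensorToL2 D j y) = inner ℂ x y := by
  induction x using TensorProduct.induction_on with
  | zero => simp
  | add x x' hx hx' => simp only [map_add, inner_add_left, hx, hx']
  | tmul n d =>
    induction y using TensorProduct.induction_on with
    | zero => simp
    | add y y' hy hy' => simp only [map_add, inner_add_right, hy, hy']
    | tmul n' d' =>
      rw [tensorToL2_tmul, tensorToL2_tmul, inner_l2Smul, slice_l2Smul, inner_smul_right,
        TensorProduct.inner_tmul, mul_comm, LinearIsometry.inner_map_map]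

variable [CompleteSpace D]

/-- The isometry `E ⊗ D → ℓ²(κ; D)`, `n ⊗ d ↦ (j(n)_k d)_k`, on the Hilbert space tensor
product. -/
def hilbertTensorToL2 : HilbertTensor E D →ₗᵢ[ℂ] lp (fun _ : κ => D) 2 where
  toLinearMap := ((tensorToL2 D j).isometryOfInner
    (inner_tensorToL2 D j)).toContinuousLinearMap.fromCompletion.toLinearMap
  norm_map' x := by
    induction x using Completion.induction_on with
    | hp =>
      exact isClosed_eq (ContinuousLinearMap.continuous _).norm continuous_norm
    | ih x =>
      rw [ContinuousLinearMap.coe_coe, ContinuousLinearMap.fromCompletion_apply_coe,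
        Completion.norm_coe]
      exact LinearIsometry.norm_map _ x

lemma hilbertTensorToL2_coe (x : E ⊗[ℂ] D) :
    hilbertTensorToL2 D j (x : HilbertTensor E D) = tensorToL2 D j x :=
  ContinuousLinearMap.fromCompletion_apply_coe
    ((tensorToL2 D j).isometryOfInner (inner_tensorToL2 D j)).toContinuousLinearMap x

variable {D}

/-- By density it suffices to compare elementary tensors. It makes `B_i^* ⊗ I` a coordinatewise
weighted backward shift. -/
lemma hilbertTensorToL2_tensorId (A : E →L[ℂ] E) {k k' : κ} {c : ℂ}
    (hA : ∀ n, j (A n) k = c * j n k') (x : HilbertTensor E D) :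
    hilbertTensorToL2 D j (tensorId D A x) k = c • hilbertTensorToL2 D j x k' := by
  let ev : κ → lp (fun _ : κ => D) 2 →L[ℂ] D := lp.evalCLM ℂ (fun _ => D) 2
  let Ψ := (hilbertTensorToL2 D j).toContinuousLinearMap
  refine hilbertTensor_ext (A := ev k ∘L Ψ ∘L tensorId D A) (B := c • (ev k' ∘L Ψ))
    (fun n d => ?_) x
  change hilbertTensorToL2 D j (tensorId D A _) k = c • hilbertTensorToL2 D j _ k'
  rw [tensorId, ContinuousLinearMap.completion_apply_coe, hilbertTensorToL2_coe,
    hilbertTensorToL2_coe, ContinuousLinearMap.rTensor_tmul, tensorToL2_tmul, tensorToL2_tmul,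
    l2Smul_apply, l2Smul_apply, hA, mul_smul]

variable [CompleteSpace E]

lemma slice_hilbertTensorToL2_mem (y : D) (x : HilbertTensor E D) :
    slice y (hilbertTensorToL2 D j x) ∈ Set.range j := by
  induction x using Completion.induction_on with
  | hp =>
    exact j.isometry.isClosedEmbedding.isClosed_range.preimage
      ((slice y).continuous.comp (hilbertTensorToL2 D j).continuous)
  | ih x =>
    rw [hilbertTensorToL2_coe]
    induction x using TensorProduct.induction_on with
    | zero => exact ⟨0, by simp⟩
    | add x x' hx hx' =>
      obtain ⟨a, ha⟩ := hx
      obtain ⟨b, hb⟩ := hx'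
      exact ⟨a + b, by rw [map_add, map_add, map_add, ha, hb]⟩
    | tmul n d => exact ⟨(inner ℂ y d : ℂ) • n, by rw [tensorToL2_tmul, slice_l2Smul, map_smul]⟩

/-- Together with `slice_hilbertTensorToL2_mem` this characterizes the range by slices, so
membership in `N_P ⊗ D` can be tested on scalar sequences. -/
lemma mem_range_hilbertTensorToL2 (x : lp (fun _ : κ => D) 2)
    (hx : ∀ y : D, slice y x ∈ Set.range j) :
    x ∈ LinearMap.range (hilbertTensorToL2 D j).toLinearMap := by
  set R := LinearMap.range (hilbertTensorToL2 D j).toLinearMap with hR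
  have hc : IsClosed (R : Set (lp (fun _ : κ => D) 2)) := by
    have := (hilbertTensorToL2 D j).isometry.isClosedEmbedding.isClosed_range
    rwa [hR, LinearMap.coe_range]
  have : CompleteSpace R := hc.completeSpace_coe
  obtain ⟨r, hr, z, hz, rfl⟩ := R.exists_add_mem_mem_orthogonal x
  -- The slice of the orthogonal part `z` at `y` is some `j (a - b)`, and its squared norm equals
  -- the inner product of the image of `(a - b) ⊗ y` with `z`, which vanishes.
  have hz0 : z = 0 := by
    ext k
    refine ext_inner_left ℂ fun y => ?_
    have h0 : slice y z = 0 := by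
      obtain ⟨w, rfl⟩ := hr
      obtain ⟨a, ha⟩ := hx y
      obtain ⟨b, hb⟩ := slice_hilbertTensorToL2_mem j y w
      have hab : j (a - b) = slice y z := by
        rw [map_sub, ha, hb, map_add]
        exact add_sub_cancel_left _ _
      rw [← inner_self_eq_zero (𝕜 := ℂ)]
      nth_rw 1 [← hab]
      rw [← inner_l2Smul]
      exact hz _ ⟨(((a - b) ⊗ₜ[ℂ] y : E ⊗[ℂ] D) : HilbertTensor E D),
        (hilbertTensorToL2_coe D j _).trans (tensorToL2_tmul D j _ _)⟩
    rw [← slice_apply, h0]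
    simp
  rw [hz0, add_zero]
  exact hr

end Tensor

/-! ### The weighted shifts and their compressions to `N_P`. -/

section Fock

variable {ι : Type*} (f : PosRegFreeHol ι) (m : ℕ) (P : Set (FreeAlgebra ℂ ι))

/-- The weight `√(b_α / b_{g_i α})` of the weighted left creation operator `W_i`. -/
def weight (i : ι) (α : FreeMonoid ι) : ℝ := √(bCoeff f m α / bCoeff f m (FreeMonoid.of i * α))

lemma inner_fockBasis (α : FreeMonoid ι) (ξ : Fock ι) : inner ℂ (fockBasis α) ξ = ξ α := by
  classical
  rw [fockBasis, lp.inner_single_left]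
  simp

lemma W_fockBasis (i : ι) (α : FreeMonoid ι) :
    W f m i (fockBasis α) = (weight f m i α : ℂ) • fockBasis (FreeMonoid.of i * α) := by
  classical
  have h1 : diag f m i (fockBasis α) = (weight f m i α : ℂ) • fockBasis α := by
    ext β
    have : diag f m i (fockBasis α) β =
      ((weight f m i β : ℝ) : ℂ) • (fockBasis α : Fock ι) β := rfl
    rw [this, lp.coeFn_smul, Pi.smul_apply, fockBasis, lp.single_apply]
    by_cases h : β = α
    · subst h; rfl
    · simp [h]
  have h2 : leftCreation i (fockBasis α) = fockBasis (FreeMonoid.of i * α) := by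
    rw [leftCreation, fockBasis, OrthogonalFamily.linearIsometry_apply_single]
    simp
  change leftCreation i (diag f m i (fockBasis α)) = _
  rw [h1, map_smul, h2]

lemma adjoint_W_apply (i : ι) (ξ : Fock ι) (α : FreeMonoid ι) :
    ContinuousLinearMap.adjoint (W f m i) ξ α =
      (weight f m i α : ℂ) * ξ (FreeMonoid.of i * α) := by
  rw [← inner_fockBasis, ContinuousLinearMap.adjoint_inner_right, W_fockBasis, inner_smul_left,
    inner_fockBasis, Complex.conj_ofReal]

lemma mem_N_iff (ξ : Fock ι) : ξ ∈ N f m P ↔ ∀ p ∈ P, ∀ α β : FreeMonoid ι,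
    inner ℂ (monomial (W f m) α (FreeAlgebra.lift ℂ (W f m) p
      (monomial (W f m) β (fockBasis 1)))) ξ = 0 := by
  rw [N, M, Submodule.orthogonal_closure, Submodule.mem_orthogonal]
  constructor
  · intro h p hp α β
    exact h _ (Submodule.subset_span ⟨p, hp, α, β, rfl⟩)
  · intro h u hu
    induction hu using Submodule.span_induction with
    | mem x hx => obtain ⟨p, hp, α, β, rfl⟩ := hx; exact h p hp α β
    | zero => exact inner_zero_left _
    | add x y _ _ hx hy => rw [inner_add_left, hx, hy, add_zero]
    | smul c x _ hx => rw [inner_smul_left, hx, mul_zero]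

/-- `W_i` maps generators of `M_P` to generators, lengthening `α` to `g_i α`. Consequently the
adjoint of the compression `B_i` is just the restriction of `W_i^*`. -/
lemma adjoint_W_mem_N (i : ι) {ξ : Fock ι} (hξ : ξ ∈ N f m P) :
    ContinuousLinearMap.adjoint (W f m i) ξ ∈ N f m P := by
  rw [mem_N_iff] at hξ ⊢
  intro p hp α β
  rw [ContinuousLinearMap.adjoint_inner_right, ← hξ p hp (FreeMonoid.of i * α) β]
  simp [monomial]

lemma adjoint_B_apply (i : ι) (n : N f m P) :
    (ContinuousLinearMap.adjoint (B f m P i) n : Fock ι) =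
      ContinuousLinearMap.adjoint (W f m i) n := by
  have : ContinuousLinearMap.adjoint (B f m P i) n =
      ⟨ContinuousLinearMap.adjoint (W f m i) n, adjoint_W_mem_N f m P i n.2⟩ := by
    refine ext_inner_left ℂ fun x => ?_
    rw [ContinuousLinearMap.adjoint_inner_right]
    change inner ℂ ((N f m P).orthogonalProjectionOnto (W f m i x)) n = _
    rw [Submodule.inner_orthogonalProjectionOnto_eq_of_mem_right,
      Submodule.coe_inner, ContinuousLinearMap.adjoint_inner_right]
  rw [this]

variable (D : Type*) [NormedAddCommGroup D] [InnerProductSpace ℂ D] [CompleteSpace D]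

lemma hilbertTensorToL2_adjointBTensor (i : ι) (x : HilbertTensor (N f m P) D)
    (α : FreeMonoid ι) :
    hilbertTensorToL2 D (N f m P).subtypeₗᵢ (adjointBTensor f m P D i x) α =
      (weight f m i α : ℂ) • hilbertTensorToL2 D (N f m P).subtypeₗᵢ x (FreeMonoid.of i * α) := by
  refine hilbertTensorToL2_tensorId (N f m P).subtypeₗᵢ _ (fun n => ?_) x
  have := congrArg (fun ξ : Fock ι => ξ α) (adjoint_B_apply f m P i n)
  exact this.trans (adjoint_W_apply f m i n α)

end Fock

/-! ### The Poisson kernel and the two directions of the model theorem. -/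

section Model

variable {ι : Type*} (f : PosRegFreeHol ι) (m : ℕ) (P : Set (FreeAlgebra ℂ ι))
  {H : Type*} [NormedAddCommGroup H] [InnerProductSpace ℂ H] [CompleteSpace H]
  {T : ι → H →L[ℂ] H}

/-- The weights telescope along a word; this is why the factor `√b_α` turns `T_i^*` into the
weighted backward shift. -/
lemma sqrt_bCoeff_eq (i : ι) (α : FreeMonoid ι) :
    weight f m i α * √(bCoeff f m (FreeMonoid.of i * α)) = √(bCoeff f m α) := by
  rw [weight, ← Real.sqrt_mul (div_nonneg (bCoeff_pos f m α).le (bCoeff_pos f m _).le),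
    div_mul_cancel₀ _ (bCoeff_pos f m _).ne']

lemma weight_pos (i : ι) (α : FreeMonoid ι) : 0 < weight f m i α :=
  Real.sqrt_pos.2 (div_pos (bCoeff_pos f m _) (bCoeff_pos f m _))

lemma inner_generator_eq {K : H →L[ℂ] Fock ι}
    (hK : ∀ i h, K (ContinuousLinearMap.adjoint (T i) h) =
      ContinuousLinearMap.adjoint (W f m i) (K h))
    (p : FreeAlgebra ℂ ι) (α β : FreeMonoid ι) (h : H) :
    inner ℂ (monomial (W f m) α (FreeAlgebra.lift ℂ (W f m) p
      (monomial (W f m) β (fockBasis 1)))) (K h) =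
    K (ContinuousLinearMap.adjoint (monomial T β) (ContinuousLinearMap.adjoint
      (FreeAlgebra.lift ℂ T p) (ContinuousLinearMap.adjoint (monomial T α) h))) 1 := by
  rw [adjoint_monomial_intertwine hK, adjoint_lift_intertwine hK, adjoint_monomial_intertwine hK,
    ← inner_fockBasis, ContinuousLinearMap.adjoint_inner_right,
    ContinuousLinearMap.adjoint_inner_right, ContinuousLinearMap.adjoint_inner_right]

lemma enorm_sqrt_smul_sq {D : Type*} [NormedAddCommGroup D] [NormedSpace ℂ D] {b : ℝ} (hb : 0 ≤ b)
    (x : D) : ‖((√b : ℝ) : ℂ) • x‖ₑ ^ 2 = ENNReal.ofReal b * ‖x‖ₑ ^ 2 := by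
  rw [enorm_sq_eq_ofReal, enorm_sq_eq_ofReal, ← ENNReal.ofReal_mul hb, norm_smul, mul_pow,
    Complex.norm_real, Real.norm_eq_abs, sq_abs, Real.sq_sqrt hb]

variable {D : Type*} [NormedAddCommGroup D] [InnerProductSpace ℂ D] [CompleteSpace D]

variable {f m P} in
-- The coefficient space `D` is arbitrary here: only the coordinate of the isometry at the empty
-- word matters, and it supplies the form `q`.
lemma mem_variety_of_isometry (hm : 1 ≤ m) (V : H →ₗᵢ[ℂ] HilbertTensor (N f m P) D)
    (hV : ∀ i h, V (ContinuousLinearMap.adjoint (T i) h) = adjointBTensor f m P D i (V h)) :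
    T ∈ variety f m P H ∧ IsPure f T := by
  let Ψ := hilbertTensorToL2 D (N f m P).subtypeₗᵢ
  let R : H →ₗᵢ[ℂ] lp (fun _ : FreeMonoid ι => D) 2 := Ψ.comp V
  have hR : ∀ i h α, R (ContinuousLinearMap.adjoint (T i) h) α =
      (weight f m i α : ℂ) • R h (FreeMonoid.of i * α) := fun i h α =>
    (congrArg (fun x => Ψ x α) (hV i h)).trans
      (hilbertTensorToL2_adjointBTensor f m P D i (V h) α)
  -- Induction on the word: the shift relation determines all coordinates from the one at the empty
  -- word.
  have hcoord : ∀ α h, R h α =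
      ((√(bCoeff f m α) : ℝ) : ℂ) • R (ContinuousLinearMap.adjoint (monomial T α) h) 1 := by
    intro α
    induction α using FreeMonoid.inductionOn' with
    | one => intro h; simp [adjoint_monomial_one, bCoeff_one]
    | of_mul i α ih =>
      intro h
      have h0 : (weight f m i α : ℂ) ≠ 0 := Complex.ofReal_ne_zero.2 (weight_pos f m i α).ne'
      have hof : monomial T (FreeMonoid.of i) = T i := by simp [monomial]
      refine (smul_right_inj h0).1 ?_
      rw [← hR, ih, adjoint_monomial_mul, hof, smul_smul, ← Complex.ofReal_mul, sqrt_bCoeff_eq]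
  have hsum : ∀ h, resolventForm f T m (fun h => ‖R h 1‖ₑ ^ 2) h = ‖h‖ₑ ^ 2 := by
    intro h
    rw [← tsum_bCoeff_eq_resolventForm f T m hm, ← R.enorm_map h, lp_enorm_sq]
    refine tsum_congr fun α => ?_
    rw [hcoord α h, enorm_sqrt_smul_sq (bCoeff_pos f m α).le]
  refine ⟨⟨mem_domain_of_resolventForm_eq hm hsum, fun p hp => ?_⟩,
    isPure_of_resolventForm_eq hm hsum⟩
  -- The vector `p(T)^* h` is shown to have norm zero: in its expansion `∑ b_β ‖R (T_β^* ·) 1‖²`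
  -- every term vanishes, because the slices of `R h` lie in `N_P`.
  have hzero : ∀ h, ContinuousLinearMap.adjoint (FreeAlgebra.lift ℂ T p) h = 0 := by
    intro h
    have h1 : ∀ β, R (ContinuousLinearMap.adjoint (monomial T β)
        (ContinuousLinearMap.adjoint (FreeAlgebra.lift ℂ T p) h)) 1 = 0 := by
      intro β
      refine ext_inner_left ℂ fun y => ?_
      rw [inner_zero_right]
      let K : H →L[ℂ] Fock ι := slice y ∘L R.toContinuousLinearMap
      have hK : ∀ i h, K (ContinuousLinearMap.adjoint (T i) h) =
          ContinuousLinearMap.adjoint (W f m i) (K h) := by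
        intro i h
        ext α
        rw [adjoint_W_apply]
        change inner ℂ y (R _ α) = _ * inner ℂ y (R h _)
        rw [hR, inner_smul_right]
      have hmem : K h ∈ N f m P := by
        obtain ⟨n, hn⟩ := slice_hilbertTensorToL2_mem (N f m P).subtypeₗᵢ y (V h)
        have : K h = n := hn.symm
        rw [this]
        exact n.2
      have h2 := (mem_N_iff f m P _).1 hmem p hp 1 β
      rw [inner_generator_eq f m hK, adjoint_monomial_one] at h2
      exact h2
    have h3 := hsum (ContinuousLinearMap.adjoint (FreeAlgebra.lift ℂ T p) h)
    rw [← tsum_bCoeff_eq_resolventForm f T m hm] at h3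
    simp only [h1, enorm_zero, ne_eq, OfNat.ofNat_ne_zero, not_false_eq_true, zero_pow, mul_zero,
      tsum_zero] at h3
    simpa using h3.symm
  have : ContinuousLinearMap.adjoint (FreeAlgebra.lift ℂ T p) = 0 :=
    ContinuousLinearMap.ext hzero
  simpa using this

variable {f m P} in
/-- The Poisson kernel of `T`, as an isometry into `N_P ⊗ D`. -/
lemma exists_isometry_of_resolventForm_eq (hm : 1 ≤ m) (hP : ∀ p ∈ P, FreeAlgebra.lift ℂ T p = 0)
    (C : H →L[ℂ] D) (hC : ∀ h, resolventForm f T m (fun h => ‖C h‖ₑ ^ 2) h = ‖h‖ₑ ^ 2) :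
    ∃ V : H →ₗᵢ[ℂ] HilbertTensor (N f m P) D, ∀ i h,
      V (ContinuousLinearMap.adjoint (T i) h) = adjointBTensor f m P D i (V h) := by
  let Ψ := hilbertTensorToL2 D (N f m P).subtypeₗᵢ
  -- These coordinates are forced by the shift relation once `C` is the coordinate at the empty
  -- word.
  let A : FreeMonoid ι → H →L[ℂ] D := fun α =>
    ((√(bCoeff f m α) : ℝ) : ℂ) • (C ∘L ContinuousLinearMap.adjoint (monomial T α))
  have hAeq : ∀ h, ∑' α, ‖A α h‖ₑ ^ 2 = ‖h‖ₑ ^ 2 := by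
    intro h
    rw [← hC h, ← tsum_bCoeff_eq_resolventForm f T m hm]
    exact tsum_congr fun α => enorm_sqrt_smul_sq (bCoeff_pos f m α).le _
  let R := ofSquareSummable A fun h => (hAeq h).le
  have hof : ∀ i, monomial T (FreeMonoid.of i) = T i := fun i => by simp [monomial]
  have hR : ∀ i h α, R (ContinuousLinearMap.adjoint (T i) h) α =
      (weight f m i α : ℂ) • R h (FreeMonoid.of i * α) := by
    intro i h α
    change ((√(bCoeff f m α) : ℝ) : ℂ) • C (ContinuousLinearMap.adjoint (monomial T α) _) =
      _ • ((√(bCoeff f m _) : ℝ) : ℂ) •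
        C (ContinuousLinearMap.adjoint (monomial T (FreeMonoid.of i * α)) h)
    rw [smul_smul, ← Complex.ofReal_mul, sqrt_bCoeff_eq, adjoint_monomial_mul, hof]
  have hmem : ∀ h, R h ∈ LinearMap.range Ψ.toLinearMap := by
    intro h
    refine mem_range_hilbertTensorToL2 _ _ fun y => ?_
    let K : H →L[ℂ] Fock ι := slice y ∘L R
    have hK : ∀ i h, K (ContinuousLinearMap.adjoint (T i) h) =
        ContinuousLinearMap.adjoint (W f m i) (K h) := by
      intro i h
      ext α
      rw [adjoint_W_apply]
      change inner ℂ y (R _ α) = _ * inner ℂ y (R h _)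
      rw [hR, inner_smul_right]
    have hN : K h ∈ N f m P := by
      refine (mem_N_iff f m P _).2 fun p hp α β => ?_
      rw [inner_generator_eq f m hK, hP p hp]
      simp
    exact ⟨⟨K h, hN⟩, rfl⟩
  -- `R` takes values in the range of the isometry `Ψ`, so it can be pulled back to `N_P ⊗ D`.
  let V' : H →ₗ[ℂ] HilbertTensor (N f m P) D :=
    Ψ.equivRange.symm.toLinearEquiv.toLinearMap ∘ₗ R.toLinearMap.codRestrict _ hmem
  have hV' : ∀ h, Ψ (V' h) = R h := fun h =>
    congrArg Subtype.val (Ψ.equivRange.apply_symm_apply ⟨R h, hmem h⟩)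
  have hnorm : ∀ h, ‖V' h‖ = ‖h‖ := by
    intro h
    rw [← Ψ.norm_map, hV']
    have : ‖R h‖ₑ ^ 2 = ‖h‖ₑ ^ 2 := (lp_enorm_sq _).trans (hAeq h)
    exact le_antisymm (norm_le_of_enorm_sq_le this.le) (norm_le_of_enorm_sq_le this.ge)
  refine ⟨⟨V', hnorm⟩, fun i h => Ψ.injective ?_⟩
  change Ψ (V' _) = Ψ (adjointBTensor f m P D i (V' h))
  ext α
  rw [hilbertTensorToL2_adjointBTensor, hV', hR]
  exact congrArg (fun x : lp (fun _ : FreeMonoid ι => D) 2 =>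
    (weight f m i α : ℂ) • x (FreeMonoid.of i * α)) (hV' h).symm

end Model

end NCVariety

end

/-! ### The theorem: closed invariant subspaces correspond to ranges of intertwining isometries. -/

theorem mainTheorem3 {ι : Type*} [Countable ι] (f : NCVariety.PosRegFreeHol ι) (m : ℕ)
    (hm : 1 ≤ m) (P : Set (FreeAlgebra ℂ ι))
    {H : Type*} [NormedAddCommGroup H] [InnerProductSpace ℂ H] [CompleteSpace H]
    (T : ι → H →L[ℂ] H) :
    (T ∈ NCVariety.variety f m P H ∧ NCVariety.IsPure f T) ↔
      ∃ (G : Submodule ℂ (NCVariety.HilbertTensor (NCVariety.N f m P) (NCVariety.defectSpace f m T)))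
        (hG : ∀ i, ∀ x ∈ G,
          NCVariety.adjointBTensor f m P (NCVariety.defectSpace f m T) i x ∈ G)
        (U : H ≃ₗᵢ[ℂ] G),
        IsClosed (G : Set (NCVariety.HilbertTensor (NCVariety.N f m P) (NCVariety.defectSpace f m T))) ∧
        ∀ (i : ι) (h : H), ContinuousLinearMap.adjoint (T i) h =
          U.symm ⟨NCVariety.adjointBTensor f m P (NCVariety.defectSpace f m T) i (U h),
            hG i (U h) (U h).2⟩ := by
  constructor
  · rintro ⟨⟨hT, hP⟩, hp⟩
    -- The square root of the defect, viewed in the closure of its range, has `‖C h‖²` equal to the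
    -- quadratic form of the defect.
    let C : H →L[ℂ] NCVariety.defectSpace f m T :=
      (CFC.sqrt (NCVariety.defect f T m)).codRestrict (NCVariety.defectSpace f m T)
        fun h => Submodule.le_topologicalClosure _ ⟨h, rfl⟩
    have hC : ∀ h, NCVariety.resolventForm f T m (fun h => ‖C h‖ₑ ^ 2) h = ‖h‖ₑ ^ 2 := by
      intro h
      rw [← congrFun (NCVariety.resolventForm_opForm_defect hT hp) h]
      congr 1
      ext h
      exact (NCVariety.opForm_eq_enorm_sqrt (hT.2 m hm le_rfl) h).symm
    obtain ⟨V, hV⟩ := NCVariety.exists_isometry_of_resolventForm_eq hm hP C hC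
    have hG : ∀ i, ∀ x ∈ LinearMap.range V.toLinearMap,
        NCVariety.adjointBTensor f m P (NCVariety.defectSpace f m T) i x ∈
          LinearMap.range V.toLinearMap := by
      rintro i _ ⟨h, rfl⟩
      exact ⟨_, hV i h⟩
    refine ⟨LinearMap.range V.toLinearMap, hG, V.equivRange, ?_, fun i h => ?_⟩
    · rw [LinearMap.coe_range]
      exact V.isometry.isClosedEmbedding.isClosed_range
    · rw [LinearIsometryEquiv.eq_symm_apply]
      exact Subtype.ext (hV i h)
  · rintro ⟨G, hG, U, -, hU⟩
    refine NCVariety.mem_variety_of_isometry hm (G.subtypeₗᵢ.comp U.toLinearIsometry)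
      fun i h => ?_
    have h1 := (LinearIsometryEquiv.eq_symm_apply U).1 (hU i h)
    exact congrArg Subtype.val h1
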